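/- Let $\rho>0$, let $W$ be a standard Brownian motion with $W(0)=0$, and for $\sigma\ge 0$, $\tau>0$, $x_0>0$ let $$x_{i+1}=a_i x_i,\qquad a_i = 1+\rho\, e^{\sigma W(t_i)-\frac12\sigma^2 t_i},\qquad t_i=i\tau,\quad i=0,1,2,\dots$$ For $\beta\ge 0$ define the Lyapunov exponent $$\lambda(\rho,\beta)=\lim_{n\to\infty}\frac1n\log \mathbb{E}[x_n],$$ where the limit is taken at fixed $\beta=\frac12\sigma^2\tau n^2$; that is, for each $n\ge 1$ the variable $x_n$ is computed with parameters $\sigma=\sigma_n\ge 0$ and $\tau=\tau_n>0$ satisfying $\frac12\sigma_n^2\tau_n n^2=\beta$ (so $\sigma_n>0$ unless $\beta=0$). The expectations are finite, and for all $\rho>0$, $\beta\ge 0$ this limit exists as a real number that does not depend on $x_0$, on the Brownian motion, or on the choice of the sequences $(\sigma_n)$, $(\tau_n)$. Moreover: (i) For every $\rho>0$, $\lambda(\rho,0)=\log(1+\rho)$ and $\lim_{\beta\to 0^+}\lambda(\rho,\beta)=\log(1+\rho)$. (ii) For all $\rho>0$ and $\beta\ge 0$, $$\frac{\beta}{3}+\log\rho\;\le\;\lambda(\rho,\beta)\;\le\;\frac{\beta}{3}+\log(1+\rho).$$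 (iii) For every $\rho>0$, $\displaystyle\lim_{\beta\to\infty}\frac{\lambda(\rho,\beta)}{\beta}=\frac13$, and for every $\beta\ge 0$, $\displaystyle\lim_{\rho\to\infty}\left|\lambda(\rho,\beta)-\frac{\beta}{3}-\log\rho\right|=0$. -/

import Mathlib

open MeasureTheory ProbabilityTheory Filter Topology
open scoped NNReal

universe u

/-- The multiplier `a_i = 1 + ρ exp(σ W(t_i) - σ² t_i / 2)` with `t_i = i τ`. -/
noncomputable def multiplier {Ω : Type*} (W : ℝ≥0 → Ω → ℝ) (ρ σ : ℝ) (τ : ℝ≥0)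
    (i : ℕ) (ω : Ω) : ℝ :=
  1 + ρ * Real.exp (σ * W (i * τ) ω - σ ^ 2 / 2 * (i * (τ : ℝ)))

/-- The random multiplicative process `x_{i+1} = a_i x_i` started from the constant `x₀`. -/
noncomputable def growthProcess {Ω : Type*} (W : ℝ≥0 → Ω → ℝ) (x₀ ρ σ : ℝ) (τ : ℝ≥0) :
    ℕ → Ω → ℝ
  | 0, _ => x₀
  | i + 1, ω => multiplier W ρ σ τ i ω * growthProcess W x₀ ρ σ τ i ω

/-- `σ n`, `τ n` are volatilities and time steps along which `β = σ² τ n² / 2` stays fixed.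
The volatility is positive unless `β = 0`. -/
def FixedBeta (β : ℝ) (σ : ℕ → ℝ) (τ : ℕ → ℝ≥0) : Prop :=
  ∀ n : ℕ, 1 ≤ n → 0 ≤ σ n ∧ 0 < τ n ∧ 1 / 2 * σ n ^ 2 * (τ n : ℝ) * (n : ℝ) ^ 2 = β

/-- `l` is the Lyapunov exponent `lim (1/n) log E[x_n]`, the limit being taken as `n → ∞` at fixed
`β = σ² τ n² / 2`: the expectations are finite and the limit exists and equals `l`, whatever the
Brownian motion, the starting point, and the way in which `σ` and `τ` depend on `n`. -/
def IsLyapunovExponent (ρ β l : ℝ) : Prop :=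
  ∀ (Ω : Type u) [MeasurableSpace Ω] (P : Measure Ω) [IsProbabilityMeasure P]
    (W : ℝ≥0 → Ω → ℝ), IsBrownianReal W P →
    ∀ x₀ : ℝ, 0 < x₀ → ∀ (σ : ℕ → ℝ) (τ : ℕ → ℝ≥0), FixedBeta β σ τ →
      (∀ n, Integrable (growthProcess W x₀ ρ (σ n) (τ n) n) P) ∧
      Tendsto (fun n : ℕ =>
          1 / (n : ℝ) * Real.log (∫ ω, growthProcess W x₀ ρ (σ n) (τ n) n ω ∂P))
        atTop (𝓝 l)

/-! Expanding the product over subsets `S` of `{0, …, n - 1}` and using Gaussian exponential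
moments, `E[x_n]` is `x₀` times the sum of `ρ ^ #S * exp (β / n² * E(S))`, with `E(S)` the sum of
`min i j` over ordered pairs of distinct elements of `S`. Up to an error of at most `2 n²`, hence a
factor in `[exp (-2β), 1]` that `1/n * log` does not see, `E(S)` may be replaced by `energy n S`, a
sum of squares of tail counts, which suits Cauchy–Schwarz.

For the resulting sum `Z_n`, cutting `{0, …, nk - 1}` into `k` residue classes gives `Z_{nk} ≤ Z_n ^
k` (`partitionSum_mul_le`), and `Z_{n+1} ≤ C * Z_n` (`partitionSum_succ_le`). A Fekete-type argument
then makes `log Z_n / n` converge.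

The bounds come from `0 ≤ energy n S ≤ energy n (range n) ~ n³ / 3` and from the single term `S =
range n`; squeezing gives the asymptotics. -/

/-! ### The expectation as a finite sum -/

/-- The sum of `min i j` over `i, j ∈ S`, without the contribution of the diagonal. -/
noncomputable def offDiagEnergy (S : Finset ℕ) : ℝ :=
  ∑ i ∈ S, ∑ j ∈ S, min (i : ℝ) j - ∑ i ∈ S, (i : ℝ)

lemma growthProcess_eq_prod {Ω : Type*} (W : ℝ≥0 → Ω → ℝ) (x₀ ρ σ : ℝ) (τ : ℝ≥0) (n : ℕ) (ω : Ω) :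
    growthProcess W x₀ ρ σ τ n ω = x₀ * ∏ i ∈ Finset.range n, multiplier W ρ σ τ i ω := by
  induction n with
  | zero => simp [growthProcess]
  | succ n ih => rw [growthProcess, ih, Finset.prod_range_succ]; ring

lemma prod_exp_eq {Ω : Type*} (W : ℝ≥0 → Ω → ℝ) (σ : ℝ) (τ : ℝ≥0) (S : Finset ℕ) (ω : Ω) :
    ∏ i ∈ S, Real.exp (σ * W (i * τ) ω - σ ^ 2 / 2 * (i * (τ : ℝ)))
      = Real.exp (σ * ∑ i ∈ S, W (i * τ) ω) *
        Real.exp (-(σ ^ 2 / 2 * τ * ∑ i ∈ S, (i : ℝ))) := by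
  rw [← Real.exp_sum, ← Real.exp_add, Finset.sum_sub_distrib, Finset.mul_sum, Finset.mul_sum,
    sub_eq_add_neg]
  congr 3
  exact Finset.sum_congr rfl fun i _ => by ring

lemma growthProcess_eq_sum {Ω : Type*} (W : ℝ≥0 → Ω → ℝ) (x₀ ρ σ : ℝ) (τ : ℝ≥0) (n : ℕ)
    (ω : Ω) :
    growthProcess W x₀ ρ σ τ n ω = x₀ * ∑ S ∈ (Finset.range n).powerset, ρ ^ S.card *
      ∏ i ∈ S, Real.exp (σ * W (i * τ) ω - σ ^ 2 / 2 * (i * (τ : ℝ))) := by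
  simp [growthProcess_eq_prod, multiplier, Finset.prod_one_add, Finset.prod_mul_distrib]

section Expectation

variable {Ω : Type*} [MeasurableSpace Ω] {P : Measure Ω} [IsProbabilityMeasure P]
  {W : ℝ≥0 → Ω → ℝ}

lemma mgf_sum_brownian (hW : IsPreBrownianReal W P) (σ : ℝ) (τ : ℝ≥0) (S : Finset ℕ) :
    mgf (fun ω => ∑ i ∈ S, W (i * τ) ω) P σ
      = Real.exp (σ ^ 2 / 2 * τ * ∑ i ∈ S, ∑ j ∈ S, min (i : ℝ) j) := by
  have hlaw : HasGaussianLaw (fun ω => ∑ i ∈ S, W (i * τ) ω) P :=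
    (hW.isGaussianProcess.comp_right (fun i : ℕ => (i * τ : ℝ≥0))).hasGaussianLaw_fun_sum
  rw [mgf_gaussianReal hlaw.map_eq_gaussianReal, Real.coe_toNNReal _ (variance_nonneg _ _),
    integral_finsetSum _ (fun i _ => hW.integrable_eval _),
    variance_fun_sum' (fun i _ => (hW.isGaussianProcess.hasGaussianLaw_eval _).memLp_two)]
  simp only [hW.integral_eval, hW.covariance_eval]
  have hmin : ∀ i j : ℕ, ((min (i * τ) (j * τ) : ℝ≥0) : ℝ) = τ * min (i : ℝ) j := fun i j => by
    rw [NNReal.coe_min, mul_min_of_nonneg (i : ℝ) j τ.coe_nonneg]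
    simp [mul_comm]
  simp only [hmin, ← Finset.mul_sum]
  congr 1
  simp
  ring

lemma integrable_prod_exp (hW : IsPreBrownianReal W P) (σ : ℝ) (τ : ℝ≥0) (S : Finset ℕ) :
    Integrable (fun ω => ∏ i ∈ S, Real.exp (σ * W (i * τ) ω - σ ^ 2 / 2 * (i * (τ : ℝ)))) P := by
  simp only [prod_exp_eq]
  refine Integrable.mul_const ?_ _
  rw [← mgf_pos_iff (X := fun ω => ∑ i ∈ S, W (i * τ) ω), mgf_sum_brownian hW]
  exact Real.exp_pos _

/-- The compensators `σ² t_i / 2` cancel exactly the diagonal `i = j` of the covariance sum. -/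
lemma integral_prod_exp (hW : IsPreBrownianReal W P) (σ : ℝ) (τ : ℝ≥0) (S : Finset ℕ) :
    ∫ ω, ∏ i ∈ S, Real.exp (σ * W (i * τ) ω - σ ^ 2 / 2 * (i * (τ : ℝ))) ∂P
      = Real.exp (σ ^ 2 / 2 * τ * offDiagEnergy S) := by
  simp only [prod_exp_eq]
  have h := mgf_sum_brownian hW σ τ S
  rw [mgf] at h
  rw [integral_mul_const, h, ← Real.exp_add, offDiagEnergy]
  congr 1
  ring

lemma integrable_growthProcess (hW : IsPreBrownianReal W P) (x₀ ρ σ : ℝ) (τ : ℝ≥0) (n : ℕ) :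
    Integrable (growthProcess W x₀ ρ σ τ n) P := by
  rw [funext (growthProcess_eq_sum W x₀ ρ σ τ n)]
  exact (integrable_finsetSum _ fun S _ =>
    (integrable_prod_exp hW σ τ S).const_mul _).const_mul _

lemma integral_growthProcess (hW : IsPreBrownianReal W P) (x₀ ρ σ : ℝ) (τ : ℝ≥0) (n : ℕ) :
    ∫ ω, growthProcess W x₀ ρ σ τ n ω ∂P = x₀ * ∑ S ∈ (Finset.range n).powerset,
      ρ ^ S.card * Real.exp (σ ^ 2 / 2 * τ * offDiagEnergy S) := by
  simp only [growthProcess_eq_sum]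
  rw [integral_const_mul, integral_finsetSum _ fun S _ =>
    (integrable_prod_exp hW σ τ S).const_mul _]
  simp only [integral_const_mul, integral_prod_exp hW]

end Expectation

/-! ### A mean-field partition sum -/

/-- The number of elements of `S` that are at least `r`. -/
def tailCount (S : Finset ℕ) (r : ℕ) : ℝ := ((S.filter (r ≤ ·)).card : ℝ)

/-- The energy `∑_{r < n} #{i ∈ S | r ≤ i} ^ 2`. -/
def energy (n : ℕ) (S : Finset ℕ) : ℝ := ∑ r ∈ Finset.range n, tailCount S r ^ 2

/-- The sum over the subsets of `{0, …, n - 1}` of the weights `ρ ^ #S * exp (β / n² * energy)`. -/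
noncomputable def partitionSum (ρ β : ℝ) (n : ℕ) : ℝ :=
  ∑ S ∈ (Finset.range n).powerset, ρ ^ S.card * Real.exp (β / (n : ℝ) ^ 2 * energy n S)

lemma tailCount_nonneg (S : Finset ℕ) (r : ℕ) : 0 ≤ tailCount S r := Nat.cast_nonneg _

lemma energy_nonneg (n : ℕ) (S : Finset ℕ) : 0 ≤ energy n S :=
  Finset.sum_nonneg fun _ _ => sq_nonneg _

lemma tailCount_le_card (S : Finset ℕ) (r : ℕ) : tailCount S r ≤ S.card :=
  Nat.cast_le.2 (Finset.card_filter_le _ _)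

lemma tailCount_mono {S T : Finset ℕ} (h : S ⊆ T) (r : ℕ) : tailCount S r ≤ tailCount T r :=
  Nat.cast_le.2 (Finset.card_le_card (Finset.filter_subset_filter _ h))

lemma energy_mono (n : ℕ) {S T : Finset ℕ} (h : S ⊆ T) : energy n S ≤ energy n T :=
  Finset.sum_le_sum fun r _ => pow_le_pow_left₀ (tailCount_nonneg S r) (tailCount_mono h r) 2

lemma card_le_of_subset_range {n : ℕ} {S : Finset ℕ} (hS : S ⊆ Finset.range n) :
    (S.card : ℝ) ≤ n := by
  simpa using Nat.cast_le (α := ℝ).2 (Finset.card_le_card hS)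

/-- Double counting: a pair `i, j` is counted once for each `r ≤ min i j`, that is `min i j + 1`
times, and all these `r` are below `n`. -/
lemma energy_eq_sum_min {n : ℕ} {S : Finset ℕ} (hS : S ⊆ Finset.range n) :
    energy n S = ∑ i ∈ S, ∑ j ∈ S, (min (i : ℝ) j + 1) := by
  have h : ∀ r, tailCount S r ^ 2
      = ∑ i ∈ S, ∑ j ∈ S, if r ≤ i ∧ r ≤ j then (1 : ℝ) else 0 := fun r => by
    simp only [tailCount, Finset.card_filter, Nat.cast_sum, sq, Finset.sum_mul_sum]
    refine Finset.sum_congr rfl fun i _ => Finset.sum_congr rfl fun j _ => ?_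
    split_ifs <;> simp_all
  simp only [energy, h]
  rw [Finset.sum_comm]
  refine Finset.sum_congr rfl fun i hi => ?_
  rw [Finset.sum_comm]
  refine Finset.sum_congr rfl fun j _ => ?_
  have hi' := Finset.mem_range.1 (hS hi)
  have : (Finset.range n).filter (fun r => r ≤ i ∧ r ≤ j) = Finset.range (min i j + 1) := by
    ext r
    simp only [Finset.mem_filter, Finset.mem_range]
    omega
  rw [← Finset.sum_filter, this]
  simp

lemma energy_eq_offDiagEnergy_add {n : ℕ} {S : Finset ℕ} (hS : S ⊆ Finset.range n) :
    energy n S = offDiagEnergy S + (∑ i ∈ S, (i : ℝ) + (S.card : ℝ) ^ 2) := by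
  rw [energy_eq_sum_min hS, offDiagEnergy]
  simp only [Finset.sum_add_distrib, Finset.sum_const, nsmul_eq_mul]
  ring

/-- Both correction terms are at most `n²`; after multiplication by `β / n²` the error is at most
`2β`, uniformly in `S`. -/
lemma energy_sub_offDiagEnergy_le {n : ℕ} {S : Finset ℕ} (hS : S ⊆ Finset.range n) :
    energy n S - offDiagEnergy S ≤ 2 * (n : ℝ) ^ 2 := by
  have h1 : ∑ i ∈ S, (i : ℝ) ≤ S.card * (n : ℝ) := by
    rw [← nsmul_eq_mul]
    exact Finset.sum_le_card_nsmul _ _ _ fun i hi =>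
      Nat.cast_le.2 (Finset.mem_range.1 (hS hi)).le
  have h2 := card_le_of_subset_range hS
  have h3 : (0 : ℝ) ≤ S.card := Nat.cast_nonneg _
  rw [energy_eq_offDiagEnergy_add hS]
  nlinarith

lemma offDiagEnergy_le_energy {n : ℕ} {S : Finset ℕ} (hS : S ⊆ Finset.range n) :
    offDiagEnergy S ≤ energy n S := by
  rw [energy_eq_offDiagEnergy_add hS]
  have : 0 ≤ ∑ i ∈ S, (i : ℝ) := Finset.sum_nonneg fun i _ => Nat.cast_nonneg i
  nlinarith [sq_nonneg (S.card : ℝ)]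

lemma energy_range (n : ℕ) :
    energy n (Finset.range n) = (n : ℝ) * (n + 1) * (2 * n + 1) / 6 := by
  have h : ∀ r ∈ Finset.range n, tailCount (Finset.range n) r ^ 2 = ((n - r : ℕ) : ℝ) ^ 2 := by
    intro r _
    have : (Finset.range n).filter (r ≤ ·) = Finset.Ico r n := by
      ext i
      simp only [Finset.mem_filter, Finset.mem_range, Finset.mem_Ico]
      omega
    rw [tailCount, this, Nat.card_Ico]
  rw [energy, Finset.sum_congr rfl h, ← Finset.sum_range_reflect]
  have h' : ∀ r ∈ Finset.range n, ((n - (n - 1 - r) : ℕ) : ℝ) ^ 2 = ((r : ℝ) + 1) ^ 2 := by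
    intro r hr
    have := Finset.mem_range.1 hr
    rw [show n - (n - 1 - r) = r + 1 by omega]
    push_cast
    rfl
  rw [Finset.sum_congr rfl h']
  clear h h'
  induction n with
  | zero => simp
  | succ n ih => rw [Finset.sum_range_succ, ih]; push_cast; ring

lemma sum_pow_card (ρ : ℝ) (n : ℕ) :
    ∑ S ∈ (Finset.range n).powerset, ρ ^ S.card = (1 + ρ) ^ n := by
  have := Finset.prod_one_add (f := fun _ : ℕ => ρ) (Finset.range n)
  simpa using this.symm

/-! ### Elementary bounds and one-step growth of the partition sum -/

section PartitionSum

variable {ρ β : ℝ}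

lemma one_add_pow_le_partitionSum (hρ : 0 < ρ) (hβ : 0 ≤ β) (n : ℕ) :
    (1 + ρ) ^ n ≤ partitionSum ρ β n := by
  rw [← sum_pow_card]
  refine Finset.sum_le_sum fun S _ => le_mul_of_one_le_right (by positivity) ?_
  exact Real.one_le_exp (mul_nonneg (by positivity) (energy_nonneg _ _))

lemma partitionSum_pos (hρ : 0 < ρ) (hβ : 0 ≤ β) (n : ℕ) : 0 < partitionSum ρ β n :=
  (by positivity : 0 < (1 + ρ) ^ n).trans_le (one_add_pow_le_partitionSum hρ hβ n)

lemma le_partitionSum (hρ : 0 < ρ) (n : ℕ) :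
    ρ ^ n * Real.exp (β / (n : ℝ) ^ 2 * energy n (Finset.range n)) ≤ partitionSum ρ β n := by
  have := Finset.single_le_sum (s := (Finset.range n).powerset)
    (f := fun S => ρ ^ S.card * Real.exp (β / (n : ℝ) ^ 2 * energy n S))
    (fun S _ => by positivity) (Finset.mem_powerset_self _)
  simpa [partitionSum] using this

lemma partitionSum_le (hρ : 0 < ρ) (hβ : 0 ≤ β) (n : ℕ) :
    partitionSum ρ β n
      ≤ (1 + ρ) ^ n * Real.exp (β / (n : ℝ) ^ 2 * energy n (Finset.range n)) := by
  rw [← sum_pow_card, Finset.sum_mul]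
  refine Finset.sum_le_sum fun S hS => ?_
  have := energy_mono n (Finset.mem_powerset.1 hS)
  gcongr

lemma energy_succ_insert_le {n : ℕ} {S : Finset ℕ} (hS : S ⊆ Finset.range n) :
    energy (n + 1) (insert n S) ≤ energy n S + 2 * ((n : ℝ) + 1) ^ 2 := by
  have hc := card_le_of_subset_range hS
  have hT : ∀ r, tailCount (insert n S) r ≤ tailCount S r + 1 := fun r => by
    unfold tailCount
    rw [Finset.filter_insert]
    split_ifs
    · exact_mod_cast Finset.card_insert_le _ _
    · linarith
  have h1 : ∀ r ∈ Finset.range (n + 1),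
      tailCount (insert n S) r ^ 2 ≤ tailCount S r ^ 2 + (2 * (n : ℝ) + 1) := fun r _ => by
    nlinarith [hT r, tailCount_nonneg (insert n S) r, tailCount_le_card S r, tailCount_nonneg S r]
  -- The extra index `r = n` contributes nothing for `S`, so the sum of squares up to `n` is still
  -- `energy n S`.
  have h0 : tailCount S n = 0 := by
    rw [tailCount, Nat.cast_eq_zero, Finset.card_eq_zero, Finset.filter_eq_empty_iff]
    intro i hi
    have := Finset.mem_range.1 (hS hi)
    omega
  refine (Finset.sum_le_sum h1).trans ?_
  rw [Finset.sum_add_distrib, Finset.sum_range_succ, h0, energy]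
  simp only [Finset.sum_const, Finset.card_range, nsmul_eq_mul]
  push_cast
  nlinarith

/-- Subsets of `range (n + 1)` pair up as `S`, `insert n S`; adding `n` costs at most `2 (n + 1)²`
in energy, hence a factor `exp (2 * β)`. -/
lemma partitionSum_succ_le (hρ : 0 < ρ) (hβ : 0 ≤ β) {n : ℕ} (hn : 0 < n) :
    partitionSum ρ β (n + 1) ≤ partitionSum ρ β n * (1 + ρ) * Real.exp (2 * β) := by
  have hn' : (0 : ℝ) < n := by exact_mod_cast hn
  have key : ∀ S ⊆ Finset.range n,
      Real.exp (β / ((n + 1 : ℕ) : ℝ) ^ 2 * energy (n + 1) (insert n S))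
        ≤ Real.exp (β / (n : ℝ) ^ 2 * energy n S) * Real.exp (2 * β) := fun S hS => by
    rw [← Real.exp_add]
    refine Real.exp_le_exp.2 ?_
    push_cast
    calc β / ((n : ℝ) + 1) ^ 2 * energy (n + 1) (insert n S)
        ≤ β / ((n : ℝ) + 1) ^ 2 * (energy n S + 2 * ((n : ℝ) + 1) ^ 2) := by
          gcongr
          exact energy_succ_insert_le hS
      _ = β / ((n : ℝ) + 1) ^ 2 * energy n S + 2 * β := by field_simp
      _ ≤ β / (n : ℝ) ^ 2 * energy n S + 2 * β := by
          have := energy_nonneg n S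
          gcongr
          linarith
  have hnot : ∀ S ⊆ Finset.range n, n ∉ S := fun S hS h => by
    simpa using hS h
  rw [partitionSum, Finset.range_add_one, Finset.sum_powerset_insert (by simp),
    ← Finset.sum_add_distrib, partitionSum, mul_assoc, Finset.sum_mul]
  refine Finset.sum_le_sum fun S hS => ?_
  rw [Finset.mem_powerset] at hS
  rw [Finset.card_insert_of_notMem (hnot S hS)]
  have h1 := key S hS
  have h2 : Real.exp (β / ((n + 1 : ℕ) : ℝ) ^ 2 * energy (n + 1) S)
        ≤ Real.exp (β / (n : ℝ) ^ 2 * energy n S) * Real.exp (2 * β) := by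
    refine le_trans ?_ h1
    have := energy_mono (n + 1) (Finset.subset_insert n S)
    gcongr
  calc _ ≤ ρ ^ S.card * (Real.exp (β / (n : ℝ) ^ 2 * energy n S) * Real.exp (2 * β))
        + ρ ^ (S.card + 1) * (Real.exp (β / (n : ℝ) ^ 2 * energy n S) * Real.exp (2 * β)) := by
        gcongr
    _ = _ := by ring

/-! ### Splitting into residue classes -/

lemma sum_range_mul_eq_sum_sum (F : ℕ → ℝ) (n k : ℕ) :
    ∑ a ∈ Finset.range (n * k), F a = ∑ i ∈ Finset.range n, ∑ l : Fin k, F (k * i + l) := by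
  induction n with
  | zero => simp
  | succ n ih =>
    rw [Nat.succ_mul, Finset.sum_range_add, ih, Finset.sum_range_succ,
      Finset.sum_range (fun x => F (n * k + x))]
    simp only [mul_comm n k]

/-- The indices of the blocks of length `k` whose `l`-th element belongs to `S`. -/
def residuePart (n k : ℕ) (S : Finset ℕ) (l : Fin k) : Finset ℕ :=
  (Finset.range n).filter fun i => k * i + l ∈ S

lemma tailCount_eq_sum {m : ℕ} {S : Finset ℕ} (hS : S ⊆ Finset.range m) (r : ℕ) :
    tailCount S r = ∑ a ∈ Finset.range m, if a ∈ S ∧ r ≤ a then (1 : ℝ) else 0 := by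
  rw [tailCount, Finset.sum_boole]
  congr 2
  ext a
  simp only [Finset.mem_filter]
  exact ⟨fun h => ⟨hS h.1, h⟩, fun h => h.2⟩

lemma tailCount_residuePart (n k : ℕ) (S : Finset ℕ) (l : Fin k) (r : ℕ) :
    tailCount (residuePart n k S l) r
      = ∑ i ∈ Finset.range n, if k * i + l ∈ S ∧ r ≤ i then (1 : ℝ) else 0 := by
  rw [tailCount_eq_sum (m := n) (S := residuePart n k S l) (Finset.filter_subset _ _)]
  refine Finset.sum_congr rfl fun i hi => ?_
  simp [residuePart, Finset.mem_range.1 hi]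

lemma tailCount_le_sum_residuePart {n k : ℕ} {S : Finset ℕ} (hS : S ⊆ Finset.range (n * k))
    (r m : ℕ) : tailCount S (k * r + m) ≤ ∑ l, tailCount (residuePart n k S l) r := by
  simp only [tailCount_residuePart]
  rw [tailCount_eq_sum hS, sum_range_mul_eq_sum_sum, Finset.sum_comm]
  refine Finset.sum_le_sum fun l _ => Finset.sum_le_sum fun i _ => ?_
  -- An element in a block before the `r`-th lies below `k * r`, since `l < k`.
  have h : k * r + m ≤ k * i + l → r ≤ i := fun h => by
    by_contra! hlt
    have h1 : k * (i + 1) ≤ k * r := Nat.mul_le_mul_left k hlt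
    have h2 := l.2
    rw [mul_add] at h1
    omega
  split_ifs <;> first | positivity | simp_all

lemma card_eq_sum_residuePart {n k : ℕ} {S : Finset ℕ} (hS : S ⊆ Finset.range (n * k)) :
    S.card = ∑ l, (residuePart n k S l).card := by
  have h0 : ∀ T : Finset ℕ, (T.card : ℝ) = tailCount T 0 := fun T => by simp [tailCount]
  refine Nat.cast_injective (R := ℝ) ?_
  rw [Nat.cast_sum]
  simp only [h0, tailCount_residuePart]
  rw [tailCount_eq_sum hS, sum_range_mul_eq_sum_sum, Finset.sum_comm]
  simp

/-- Cauchy–Schwarz over the `k` classes gives one factor `k`; the `k` thresholds `k * r + m` in a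
block give the other. -/
lemma energy_mul_le {n k : ℕ} {S : Finset ℕ} (hS : S ⊆ Finset.range (n * k)) :
    energy (n * k) S ≤ (k : ℝ) ^ 2 * ∑ l, energy n (residuePart n k S l) := by
  simp only [energy]
  rw [sum_range_mul_eq_sum_sum, Finset.sum_comm (s := Finset.univ) (t := Finset.range n),
    Finset.mul_sum]
  refine Finset.sum_le_sum fun r _ => ?_
  have h : ∀ m : Fin k, tailCount S (k * r + m) ^ 2
      ≤ k * ∑ l, tailCount (residuePart n k S l) r ^ 2 := fun m => by
    refine (pow_le_pow_left₀ (tailCount_nonneg _ _)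
      (tailCount_le_sum_residuePart hS r m) 2).trans ?_
    simpa using sq_sum_le_card_mul_sum_sq (s := (Finset.univ : Finset (Fin k)))
      (f := fun l => tailCount (residuePart n k S l) r)
  refine (Finset.sum_le_sum fun m _ => h m).trans_eq ?_
  simp only [Finset.sum_const, Finset.card_univ, Fintype.card_fin, nsmul_eq_mul]
  ring

lemma residuePart_injOn (n k : ℕ) :
    Set.InjOn (fun S l => residuePart n k S l)
      ((Finset.range (n * k)).powerset : Set (Finset ℕ)) := by
  have aux : ∀ S T : Finset ℕ, S ⊆ Finset.range (n * k) →
      (∀ l, residuePart n k S l = residuePart n k T l) → S ⊆ T := fun S T hS h a ha => by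
    have hlt := Finset.mem_range.1 (hS ha)
    have hk : 0 < k := Nat.pos_of_ne_zero fun h0 => by simp [h0] at hlt
    have hdiv : a / k < n := (Nat.div_lt_iff_lt_mul hk).2 hlt
    have hmem : a / k ∈ residuePart n k S ⟨a % k, Nat.mod_lt _ hk⟩ := by
      simp [residuePart, hdiv, Nat.div_add_mod, ha]
    rw [h] at hmem
    simpa [residuePart, hdiv, Nat.div_add_mod] using hmem
  intro S hS T hT h
  simp only [Finset.coe_powerset, Set.mem_preimage, Set.mem_powerset_iff, Finset.coe_subset]
    at hS hT
  exact (aux S T hS fun l => congrFun h l).antisymm (aux T S hT fun l => (congrFun h l).symm)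

/-- The `k²` of `energy_mul_le` cancels against `(n * k)²`, so each weight is at most the product of
the weights of the residue parts. As `S` is determined by these parts, the sum is dominated by the
one over all `k`-tuples of subsets. -/
lemma partitionSum_mul_le (hρ : 0 < ρ) (hβ : 0 ≤ β) (n : ℕ) {k : ℕ} (hk : 0 < k) :
    partitionSum ρ β (n * k) ≤ partitionSum ρ β n ^ k := by
  have hk' : (0 : ℝ) < k := by exact_mod_cast hk
  let g : Finset ℕ → ℝ := fun S => ρ ^ S.card * Real.exp (β / (n : ℝ) ^ 2 * energy n S)
  have hg : ∀ S, 0 ≤ g S := fun S => by positivity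
  have hpow : partitionSum ρ β n ^ k
      = ∑ p ∈ Fintype.piFinset (fun _ : Fin k => (Finset.range n).powerset), ∏ l, g (p l) := by
    rw [← Finset.prod_univ_sum (fun _ : Fin k => (Finset.range n).powerset) (fun _ => g)]
    simp [partitionSum, g]
  have hterm : ∀ S ∈ (Finset.range (n * k)).powerset,
      ρ ^ S.card * Real.exp (β / ((n * k : ℕ) : ℝ) ^ 2 * energy (n * k) S)
        ≤ ∏ l, g (residuePart n k S l) := fun S hS => by
    rw [Finset.mem_powerset] at hS
    simp only [g]
    rw [Finset.prod_mul_distrib, Finset.prod_pow_eq_pow_sum, ← card_eq_sum_residuePart hS,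
      ← Real.exp_sum, ← Finset.mul_sum]
    refine mul_le_mul_of_nonneg_left (Real.exp_le_exp.2 ?_) (by positivity)
    calc _ ≤ β / ((n * k : ℕ) : ℝ) ^ 2 * ((k : ℝ) ^ 2 * ∑ l, energy n (residuePart n k S l)) := by
          gcongr
          exact energy_mul_le hS
      _ = _ := by
          rw [← mul_assoc]
          congr 1
          push_cast
          rw [mul_pow, ← div_div, div_mul_cancel₀ _ (by positivity)]
  rw [hpow]
  refine (Finset.sum_le_sum hterm).trans ?_
  rw [← Finset.sum_image (f := fun p : Fin k → Finset ℕ => ∏ l, g (p l)) (residuePart_injOn n k)]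
  refine Finset.sum_le_sum_of_subset_of_nonneg ?_ fun p _ _ => Finset.prod_nonneg fun l _ => hg _
  intro p hp
  obtain ⟨S, -, rfl⟩ := Finset.mem_image.1 hp
  simp [Fintype.mem_piFinset, residuePart]

end PartitionSum

/-! ### Existence of the limit -/

/-- Fekete's argument with subadditivity only along multiples: the limit is the infimum of `u n / n`
over `n ≥ 1`, and the increment bound handles remainders modulo `n`. -/
lemma tendsto_div_of_mul_le_of_succ_le {u : ℕ → ℝ} {C : ℝ} (h0 : ∀ n, 0 ≤ u n)
    (hmul : ∀ n k, 0 < k → u (n * k) ≤ k * u n) (hsucc : ∀ n, 0 < n → u (n + 1) ≤ u n + C) :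
    ∃ L, Tendsto (fun n : ℕ => u n / n) atTop (𝓝 L) := by
  have hadd : ∀ n, 0 < n → ∀ r : ℕ, u (n + r) ≤ u n + r * C := fun n hn r => by
    induction r with
    | zero => simp
    | succ r ih =>
      have := hsucc (n + r) (by omega)
      push_cast
      rw [← add_assoc]
      linarith
  have hbdd : BddBelow ((fun n : ℕ => u n / n) '' Set.Ici 1) :=
    ⟨0, by rintro _ ⟨n, -, rfl⟩; exact div_nonneg (h0 n) n.cast_nonneg⟩
  refine ⟨sInf ((fun n : ℕ => u n / n) '' Set.Ici 1),
    tendsto_order.2 ⟨fun l hl => ?_, fun l hl => ?_⟩⟩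
  · filter_upwards [eventually_ge_atTop 1] with n hn
    exact hl.trans_le (csInf_le hbdd ⟨n, hn, rfl⟩)
  · obtain ⟨_, ⟨n, hn, rfl⟩, hnl⟩ := exists_lt_of_csInf_lt (Set.nonempty_Ici.image _) hl
    have hn' : (0 : ℝ) < n := by exact_mod_cast Nat.lt_of_lt_of_le Nat.zero_lt_one hn
    have hn0 : 0 < n := hn
    -- With a near-optimal `n` fixed, it suffices to treat each progression `n * k + r` as `k → ∞`.
    refine Eventually.atTop_of_arithmetic hn0.ne' fun r _ => ?_
    have hlim : Tendsto (fun k : ℕ => u n / n + (r * |C| / n) / (k : ℝ)) atTop (𝓝 (u n / n + 0)) :=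
      tendsto_const_nhds.add (tendsto_const_nhds.div_atTop tendsto_natCast_atTop_atTop)
    rw [add_zero] at hlim
    filter_upwards [hlim.eventually (gt_mem_nhds hnl), eventually_gt_atTop 0] with k hk hk0
    refine lt_of_le_of_lt ?_ hk
    have hk' : (0 : ℝ) < k := by exact_mod_cast hk0
    have h1 : u (n * k + r) ≤ k * u n + r * |C| := by
      have := hadd (n * k) (Nat.mul_pos hn0 hk0) r
      have := hmul n k hk0
      have : (r : ℝ) * C ≤ r * |C| := by gcongr; exact le_abs_self C
      linarith
    have h2 : (0 : ℝ) ≤ k * u n + r * |C| := by have := h0 n; positivity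
    calc u (n * k + r) / ((n * k + r : ℕ) : ℝ) ≤ (k * u n + r * |C|) / (n * k : ℝ) := by
          push_cast
          gcongr
          linarith [r.cast_nonneg (α := ℝ)]
      _ = u n / n + (r * |C| / n) / (k : ℝ) := by field_simp

lemma exists_tendsto_log_partitionSum {ρ β : ℝ} (hρ : 0 < ρ) (hβ : 0 ≤ β) :
    ∃ L, Tendsto (fun n : ℕ => Real.log (partitionSum ρ β n) / n) atTop (𝓝 L) := by
  refine tendsto_div_of_mul_le_of_succ_le (C := Real.log (1 + ρ) + 2 * β) (fun n => ?_)
    (fun n k hk => ?_) (fun n hn => ?_)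
  · exact Real.log_nonneg
      ((one_le_pow₀ (by linarith)).trans (one_add_pow_le_partitionSum hρ hβ n))
  · rw [← Real.log_pow]
    exact Real.log_le_log (partitionSum_pos hρ hβ _) (partitionSum_mul_le hρ hβ n hk)
  · have h := Real.log_le_log (partitionSum_pos hρ hβ _) (partitionSum_succ_le hρ hβ hn)
    have h0 := partitionSum_pos hρ hβ n
    rwa [Real.log_mul (by positivity) (by positivity), Real.log_mul h0.ne' (by positivity),
      Real.log_exp, add_assoc] at h

/-! ### Bounds on the limit -/

section Bounds

variable {ρ β L : ℝ}

lemma log_one_add_le_of_tendsto (hρ : 0 < ρ) (hβ : 0 ≤ β)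
    (hL : Tendsto (fun n : ℕ => Real.log (partitionSum ρ β n) / n) atTop (𝓝 L)) :
    Real.log (1 + ρ) ≤ L := by
  refine ge_of_tendsto hL ?_
  filter_upwards [eventually_gt_atTop 0] with n hn
  have hn' : (0 : ℝ) < n := by exact_mod_cast hn
  rw [le_div_iff₀ hn', mul_comm, ← Real.log_pow]
  exact Real.log_le_log (by positivity) (one_add_pow_le_partitionSum hρ hβ n)

lemma add_log_le_of_tendsto (hρ : 0 < ρ) (hβ : 0 ≤ β)
    (hL : Tendsto (fun n : ℕ => Real.log (partitionSum ρ β n) / n) atTop (𝓝 L)) :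
    β / 3 + Real.log ρ ≤ L := by
  refine ge_of_tendsto hL ?_
  filter_upwards [eventually_gt_atTop 0] with n hn
  have hn' : (0 : ℝ) < n := by exact_mod_cast hn
  have h := Real.log_le_log (by positivity) (le_partitionSum (β := β) hρ n)
  rw [Real.log_mul (by positivity) (by positivity), Real.log_exp, Real.log_pow, energy_range] at h
  rw [le_div_iff₀ hn']
  refine le_trans ?_ h
  have : β / (n : ℝ) ^ 2 * ((n : ℝ) * (n + 1) * (2 * n + 1) / 6)
      = β / 3 * n + β / 2 + β / (6 * n) := by field_simp; ring
  rw [this]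
  have : 0 ≤ β / (6 * n) := by positivity
  linarith

lemma le_add_log_of_tendsto (hρ : 0 < ρ) (hβ : 0 ≤ β)
    (hL : Tendsto (fun n : ℕ => Real.log (partitionSum ρ β n) / n) atTop (𝓝 L)) :
    L ≤ β / 3 + Real.log (1 + ρ) := by
  -- The slack `β / n` absorbs the lower-order terms of the full energy: `β / 2 + β / (6 * n) ≤ β`.
  have hlim : Tendsto (fun n : ℕ => β / 3 + Real.log (1 + ρ) + β / (n : ℝ)) atTop
      (𝓝 (β / 3 + Real.log (1 + ρ) + 0)) :=
    tendsto_const_nhds.add (tendsto_const_nhds.div_atTop tendsto_natCast_atTop_atTop)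
  rw [add_zero] at hlim
  refine le_of_tendsto_of_tendsto hL hlim ?_
  filter_upwards [eventually_gt_atTop 0] with n hn
  have hn' : (1 : ℝ) ≤ n := by exact_mod_cast hn
  have h := Real.log_le_log (partitionSum_pos hρ hβ n) (partitionSum_le hρ hβ n)
  rw [Real.log_mul (by positivity) (by positivity), Real.log_exp, Real.log_pow, energy_range] at h
  rw [div_le_iff₀ (by linarith)]
  refine h.trans ?_
  have h1 : β / (n : ℝ) ^ 2 * ((n : ℝ) * (n + 1) * (2 * n + 1) / 6)
      = β / 3 * n + β / 2 + β / (6 * n) := by field_simp; ring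
  have h2 : β / (6 * n) ≤ β / 6 := div_le_div_of_nonneg_left hβ (by norm_num) (by linarith)
  have h3 : β / (n : ℝ) * n = β := div_mul_cancel₀ _ (by linarith)
  rw [h1, add_mul, add_mul, h3]
  linarith

end Bounds

/-! ### Return to the growth process and its asymptotics -/

/-- The sum in `integral_growthProcess` differs from the partition sum by a bounded factor. -/
lemma isLyapunovExponent_of_tendsto {ρ β L : ℝ} (hρ : 0 < ρ) (hβ : 0 ≤ β)
    (hL : Tendsto (fun n : ℕ => Real.log (partitionSum ρ β n) / n) atTop (𝓝 L)) :
    IsLyapunovExponent.{u} ρ β L := by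
  intro Ω _ P _ W hW x₀ hx₀ σ τ hστ
  refine ⟨fun n => integrable_growthProcess hW.toIsPreBrownianReal _ _ _ _ _, ?_⟩
  have hzero : ∀ c : ℝ, Tendsto (fun n : ℕ => c / (n : ℝ)) atTop (𝓝 0) := fun c =>
    tendsto_const_nhds.div_atTop tendsto_natCast_atTop_atTop
  have hup := hL.add (hzero (Real.log x₀))
  have hlow := hL.add (hzero (Real.log x₀ - 2 * β))
  rw [add_zero] at hup hlow
  have hbounds : ∀ n : ℕ, 0 < n →
      x₀ * (partitionSum ρ β n * Real.exp (-(2 * β)))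
        ≤ ∫ ω, growthProcess W x₀ ρ (σ n) (τ n) n ω ∂P ∧
      ∫ ω, growthProcess W x₀ ρ (σ n) (τ n) n ω ∂P ≤ x₀ * partitionSum ρ β n := fun n hn => by
    have hn' : (0 : ℝ) < n := by exact_mod_cast hn
    have hb : σ n ^ 2 / 2 * (τ n : ℝ) = β / (n : ℝ) ^ 2 := by
      rw [eq_div_iff (by positivity), ← (hστ n hn).2.2]
      ring
    rw [integral_growthProcess hW.toIsPreBrownianReal, hb, partitionSum, Finset.sum_mul]
    constructor
    · refine mul_le_mul_of_nonneg_left (Finset.sum_le_sum fun S hS => ?_) hx₀.le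
      rw [mul_assoc, ← Real.exp_add]
      refine mul_le_mul_of_nonneg_left (Real.exp_le_exp.2 ?_) (by positivity)
      have h := mul_le_mul_of_nonneg_left
        (energy_sub_offDiagEnergy_le (Finset.mem_powerset.1 hS))
        (by positivity : 0 ≤ β / (n : ℝ) ^ 2)
      have h' : β / (n : ℝ) ^ 2 * (2 * (n : ℝ) ^ 2) = 2 * β := by field_simp
      rw [h', mul_sub] at h
      linarith
    · refine mul_le_mul_of_nonneg_left (Finset.sum_le_sum fun S hS => ?_) hx₀.le
      have := offDiagEnergy_le_energy (Finset.mem_powerset.1 hS)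
      gcongr
  refine tendsto_of_tendsto_of_tendsto_of_le_of_le' hlow hup ?_ ?_
  all_goals
    filter_upwards [eventually_gt_atTop 0] with n hn
    have hn' : (0 : ℝ) < n := by exact_mod_cast hn
    have hZ := partitionSum_pos hρ hβ n
    obtain ⟨h1, h2⟩ := hbounds n hn
    have hlow0 : 0 < x₀ * (partitionSum ρ β n * Real.exp (-(2 * β))) := by positivity
    rw [← add_div, one_div_mul_eq_div]
    gcongr
  · have h := Real.log_le_log hlow0 h1
    rw [Real.log_mul (by positivity) (by positivity), Real.log_mul hZ.ne' (by positivity),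
      Real.log_exp] at h
    linarith
  · have h := Real.log_le_log (hlow0.trans_le h1) h2
    rw [Real.log_mul (by positivity) (by positivity)] at h
    linarith

lemma tendsto_log_one_add_sub_log_atTop :
    Tendsto (fun ρ : ℝ => Real.log (1 + ρ) - Real.log ρ) atTop (𝓝 0) := by
  have h : Tendsto (fun ρ : ℝ => Real.log (1 + 1 / ρ)) atTop (𝓝 (Real.log (1 + 0))) :=
    ((tendsto_const_nhds.add (tendsto_const_nhds.div_atTop tendsto_id)).log (by norm_num))
  rw [add_zero, Real.log_one] at h
  refine h.congr' ?_
  filter_upwards [eventually_gt_atTop 0] with ρ hρ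
  rw [← Real.log_div (by positivity) (by positivity)]
  congr 1
  field_simp
  ring

theorem mainTheorem9 :
    ∃ lam : ℝ → ℝ → ℝ,
      (∀ ρ β : ℝ, 0 < ρ → 0 ≤ β → IsLyapunovExponent.{u} ρ β (lam ρ β)) ∧
      (∀ ρ : ℝ, 0 < ρ →
        lam ρ 0 = Real.log (1 + ρ) ∧
        Tendsto (fun β => lam ρ β) (𝓝[>] 0) (𝓝 (Real.log (1 + ρ)))) ∧
      (∀ ρ β : ℝ, 0 < ρ → 0 ≤ β →
        β / 3 + Real.log ρ ≤ lam ρ β ∧ lam ρ β ≤ β / 3 + Real.log (1 + ρ)) ∧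
      (∀ ρ : ℝ, 0 < ρ → Tendsto (fun β => lam ρ β / β) atTop (𝓝 (1 / 3))) ∧
      (∀ β : ℝ, 0 ≤ β →
        Tendsto (fun ρ => |lam ρ β - β / 3 - Real.log ρ|) atTop (𝓝 0)) := by
  have hex : ∀ ρ β : ℝ, ∃ L, 0 < ρ → 0 ≤ β →
      Tendsto (fun n : ℕ => Real.log (partitionSum ρ β n) / n) atTop (𝓝 L) := fun ρ β => by
    by_cases h : 0 < ρ ∧ 0 ≤ β
    · obtain ⟨L, hL⟩ := exists_tendsto_log_partitionSum h.1 h.2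
      exact ⟨L, fun _ _ => hL⟩
    -- Arbitrary value outside the domain `ρ > 0`, `β ≥ 0`.
    · exact ⟨0, fun h1 h2 => absurd ⟨h1, h2⟩ h⟩
  choose lam hlam using hex
  have hlow : ∀ ρ β : ℝ, 0 < ρ → 0 ≤ β → β / 3 + Real.log ρ ≤ lam ρ β := fun ρ β hρ hβ =>
    add_log_le_of_tendsto hρ hβ (hlam ρ β hρ hβ)
  have hlow' : ∀ ρ β : ℝ, 0 < ρ → 0 ≤ β → Real.log (1 + ρ) ≤ lam ρ β := fun ρ β hρ hβ =>
    log_one_add_le_of_tendsto hρ hβ (hlam ρ β hρ hβ)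
  have hup : ∀ ρ β : ℝ, 0 < ρ → 0 ≤ β → lam ρ β ≤ β / 3 + Real.log (1 + ρ) := fun ρ β hρ hβ =>
    le_add_log_of_tendsto hρ hβ (hlam ρ β hρ hβ)
  refine ⟨lam, fun ρ β hρ hβ => isLyapunovExponent_of_tendsto hρ hβ (hlam ρ β hρ hβ),
    fun ρ hρ => ⟨?_, ?_⟩, fun ρ β hρ hβ => ⟨hlow ρ β hρ hβ, hup ρ β hρ hβ⟩, fun ρ hρ => ?_,
    fun β hβ => ?_⟩
  -- The lower bound must be `log (1 + ρ)` here: the one with `log ρ` is not sharp as `β → 0`.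
  · have h1 := hlow' ρ 0 hρ le_rfl
    have h2 := hup ρ 0 hρ le_rfl
    linarith
  · have hlim : Tendsto (fun β : ℝ => β / 3 + Real.log (1 + ρ)) (𝓝[>] 0)
        (𝓝 (0 / 3 + Real.log (1 + ρ))) :=
      ((tendsto_id.mono_left nhdsWithin_le_nhds).div_const 3).add tendsto_const_nhds
    rw [zero_div, zero_add] at hlim
    refine tendsto_of_tendsto_of_tendsto_of_le_of_le' tendsto_const_nhds hlim ?_ ?_
    all_goals filter_upwards [self_mem_nhdsWithin] with β hβ
    · exact hlow' ρ β hρ (le_of_lt hβ)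
    · exact hup ρ β hρ (le_of_lt hβ)
  · have hlim : ∀ c : ℝ, Tendsto (fun β : ℝ => 1 / 3 + c / β) atTop (𝓝 (1 / 3)) := fun c => by
      simpa using (tendsto_const_nhds (x := (1 / 3 : ℝ))).add
        ((tendsto_const_nhds (x := c)).div_atTop tendsto_id)
    refine tendsto_of_tendsto_of_tendsto_of_le_of_le' (hlim (Real.log ρ))
      (hlim (Real.log (1 + ρ))) ?_ ?_
    all_goals
      filter_upwards [eventually_gt_atTop 0] with β hβ
      have h : ∀ c : ℝ, 1 / 3 + c / β = (β / 3 + c) / β := fun c => by field_simp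
      rw [h]
    · exact div_le_div_of_nonneg_right (hlow ρ β hρ hβ.le) hβ.le
    · exact div_le_div_of_nonneg_right (hup ρ β hρ hβ.le) hβ.le
  · refine squeeze_zero' (Eventually.of_forall fun _ => abs_nonneg _) ?_
      tendsto_log_one_add_sub_log_atTop
    filter_upwards [eventually_gt_atTop 0] with ρ hρ
    have h1 := hlow ρ β hρ hβ
    have h2 := hup ρ β hρ hβ
    rw [abs_of_nonneg (by linarith)]
    linarith
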